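/- Let $\log$ be the base-2 logarithm, and let $\binom{[n]}{r}\subset\{0,1\}^n$ be the set of binary vectors of length $n$ with exactly $r$ ones. An $(r,d,n)$-locally decodable code is a map $\mathsf{c}:\binom{[n]}{r}\to\{0,1\}^*$ into the finite binary strings for which there is a deterministic decoder that, given any index $j\in[n]$ and the length $\ell(\mathsf{c}(x))$ of the codeword of any $x\in\binom{[n]}{r}$, returns $x_j$ after probing, possibly adaptively, at most $d$ bits of $\mathsf{c}(x)$. Given a sequence $(r_n)_{n\ge 1}$, a sequence of maps $\mathsf{c}_n:\binom{[n]}{r_n}\to\{0,1\}^*$ is competitively optimal if $$\limsup_{n\to\infty}\frac{\mathbb{E}[\ell(\mathsf{c}_n(X^n))]}{\log\binom{n}{r_n}}<\infty,$$ where $X^n$ is uniformly distributed on $\binom{[n]}{r_n}$. Let $(r_n)_{n\ge1}$ and $(d_n)_{n\ge1}$ be sequences of nonnegative integers with $r_n\ge 1$ for all $n\ge1$ and $r_n=O(n^{1-\epsilon})$ for some $\epsilon>0$. Then there exists a competitively optimal sequence of $(r_n,d_n,n)$-locally decodable codes if and only if $d_n=\Omega(\log n)$. -/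

import Mathlib

open Filter Asymptotics

/-- The `r`-sparse binary vectors of length `n`: the elements of `{0,1}^n` of Hamming weight
exactly `r`. -/
abbrev SparseVec (n r : ℕ) : Type :=
  {x : Fin n → Bool // (Finset.univ.filter fun j => x j = true).card = r}

/-- A deterministic adaptive decision tree over binary words of length `m`: it either stops and
declares a bit, or probes one position of the word and continues according to the bit read. -/
inductive ProbeTree (m : ℕ) : Type
  | leaf (b : Bool) : ProbeTree m
  | probe (i : Fin m) (onFalse onTrue : ProbeTree m) : ProbeTree m

/-- The largest number of probes made on any branch of the tree. -/
def ProbeTree.depth {m : ℕ} : ProbeTree m → ℕ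
  | .leaf _ => 0
  | .probe _ t₀ t₁ => max t₀.depth t₁.depth + 1

/-- The bit declared by the tree when it is run on the word `w`. -/
def ProbeTree.eval {m : ℕ} (w : Fin m → Bool) : ProbeTree m → Bool
  | .leaf b => b
  | .probe i t₀ t₁ => if w i = true then t₁.eval w else t₀.eval w

/-- `c` is an `(r, d, n)`-locally decodable source code: there is a local decompressor which, given
the length of the codeword `c x` and a query index `j`, returns the bit `x j` after (possibly
adaptively) probing at most `d` bits of `c x`. -/
def IsLocallyDecodable (r d n : ℕ) (c : SparseVec n r → List Bool) : Prop :=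
  ∃ dec : (m : ℕ) → Fin n → ProbeTree m,
    (∀ m j, (dec m j).depth ≤ d) ∧
      ∀ (x : SparseVec n r) (j : Fin n), (dec (c x).length j).eval (c x).get = x.1 j

/-- The average codeword length `𝔼[ℓ(c(X))]`, for `X` uniform on the `r`-sparse vectors. -/
noncomputable def expectedLength {n r : ℕ} (c : SparseVec n r → List Bool) : ℝ :=
  (∑ x : SparseVec n r, ((c x).length : ℝ)) / (Fintype.card (SparseVec n r) : ℝ)

/-- A sequence of encoders is competitively optimal if the upper limit of
`𝔼[ℓ(c_n(X^n))] / log₂ (n choose r_n)` is finite. -/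
def IsCompetitivelyOptimal (r : ℕ → ℕ) (c : (n : ℕ) → SparseVec n (r n) → List Bool) : Prop :=
  limsup (fun n : ℕ =>
    ((expectedLength (c n) / Real.logb 2 (n.choose (r n) : ℝ) : ℝ) : EReal)) atTop < ⊤

/-! Since `r = O(n ^ (1 - ε))`, the entropy is of order at least `r log n`. Necessity: given the
codeword length, a vector is determined by the bits read while decoding its `r` ones, a partial
assignment of at most `r * d` positions. Few such assignments exist (`card_length_eq_mul_pow_le`).
With Markov's inequality, `logb_choose_le` bounds the entropy by `O(r * d)` plus a small multiple of
the expected length. Length proportional to the entropy thus forces `d ≳ log n`. Sufficiency: a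
Bloom filter with order `log n` hashes per index and order `r log n` bits has, for suitable hashes,
a false positive on at most a fraction `1 / n` of the vectors. Those are stored verbatim at `O(1)`
average cost, and the codeword length reveals which format is used. -/

/-- Sparse vectors correspond to subsets of size `r`. -/
theorem card_sparseVec (n r : ℕ) : Fintype.card (SparseVec n r) = n.choose r := by
  classical
  have e : SparseVec n r ≃ {s : Finset (Fin n) // s.card = r} :=
    { toFun := fun x => ⟨Finset.univ.filter fun j => x.1 j = true, x.2⟩
      invFun := fun s => ⟨fun j => decide (j ∈ s.1), by simpa using s.2⟩
      left_inv := fun x => by ext j; simp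
      right_inv := fun s => by ext j; simp }
  rw [Fintype.card_congr e, Fintype.card_finset_len, Fintype.card_fin]

/-- This is `(n / k) ^ k ≤ n.choose k` without division; the induction rests on `(n + 1) / (k + 1) ≤
n / k`. -/
theorem pow_le_pow_mul_choose {n k : ℕ} (h : k ≤ n) : n ^ k ≤ k ^ k * n.choose k := by
  induction k generalizing n with
  | zero => simp
  | succ k ih =>
    obtain ⟨n, rfl⟩ : ∃ m, n = m + 1 := ⟨n - 1, by omega⟩
    have hkn : k ≤ n := by omega
    rcases Nat.eq_zero_or_pos k with rfl | hk
    · simp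
    have h1 := ih hkn
    have h2 : (n + 1) * n.choose k = (n + 1).choose (k + 1) * (k + 1) :=
      Nat.add_one_mul_choose_eq n k
    have h3 : ((n + 1) * k) ^ k ≤ (n * (k + 1)) ^ k := Nat.pow_le_pow_left (by nlinarith) k
    rw [mul_pow, mul_pow] at h3
    have h4 : 0 < k ^ k := by positivity
    refine Nat.le_of_mul_le_mul_left (c := k ^ k) ?_ h4
    calc k ^ k * (n + 1) ^ (k + 1) = (n + 1) * ((n + 1) ^ k * k ^ k) := by ring
      _ ≤ (n + 1) * (n ^ k * (k + 1) ^ k) := by gcongr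
      _ ≤ (n + 1) * (k ^ k * n.choose k * (k + 1) ^ k) := by gcongr
      _ = k ^ k * (k + 1) ^ k * ((n + 1) * n.choose k) := by ring
      _ = k ^ k * (k + 1) ^ k * ((n + 1).choose (k + 1) * (k + 1)) := by rw [h2]
      _ = k ^ k * ((k + 1) ^ (k + 1) * (n + 1).choose (k + 1)) := by ring

/-- For `r = O(n ^ (1 - ε))`, the entropy `log₂ (n choose r)` is at least of order `r log₂ n`. -/
theorem exists_mul_logb_le_logb_choose {r : ℕ → ℕ} (hr_pos : ∀ n : ℕ, 1 ≤ n → 1 ≤ r n)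
    (hr : ∃ ε : ℝ, 0 < ε ∧
      (fun n : ℕ => (r n : ℝ)) =O[atTop] (fun n : ℕ => (n : ℝ) ^ (1 - ε))) :
    ∃ κ : ℝ, 0 < κ ∧ ∀ᶠ n : ℕ in atTop,
      κ * (r n * Real.logb 2 n) ≤ Real.logb 2 (n.choose (r n) : ℝ) := by
  obtain ⟨ε, hε, h⟩ := hr
  obtain ⟨C, hC⟩ := h.bound
  -- Half of the exponent absorbs the constant `C`: eventually `n / r ≥ n ^ (ε / 2)`.
  refine ⟨ε / 2, by positivity, ?_⟩
  have h1 : Tendsto (fun n : ℕ => (n : ℝ) ^ (ε / 2)) atTop atTop :=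
    (tendsto_rpow_atTop (by positivity)).comp tendsto_natCast_atTop_atTop
  filter_upwards [hC, h1.eventually_ge_atTop C, eventually_ge_atTop 1] with n hn hCn hn1
  have hn0 : (1 : ℝ) ≤ n := by exact_mod_cast hn1
  have hnpos : (0 : ℝ) < n := by linarith
  have hr1 : (1 : ℝ) ≤ r n := by exact_mod_cast hr_pos n hn1
  have hy : (1 : ℝ) ≤ (n : ℝ) ^ (ε / 2) := Real.one_le_rpow hn0 (by positivity)
  have hrn : (r n : ℝ) * (n : ℝ) ^ (ε / 2) ≤ n := by
    rw [Real.norm_of_nonneg (by positivity), Real.norm_of_nonneg (by positivity)] at hn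
    calc (r n : ℝ) * (n : ℝ) ^ (ε / 2)
        ≤ ((n : ℝ) ^ (ε / 2) * (n : ℝ) ^ (1 - ε)) * (n : ℝ) ^ (ε / 2) := by
          gcongr
          exact hn.trans (by gcongr)
      _ = n := by
          rw [← Real.rpow_add hnpos, ← Real.rpow_add hnpos]
          ring_nf
          exact Real.rpow_one _
  have hle : r n ≤ n := by
    have : (r n : ℝ) ≤ n := by nlinarith
    exact_mod_cast this
  have hch : ((n : ℝ)) ^ r n ≤ (r n : ℝ) ^ r n * (n.choose (r n) : ℝ) := by
    exact_mod_cast pow_le_pow_mul_choose hle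
  have hkey : ((n : ℝ) ^ (ε / 2)) ^ r n ≤ (n.choose (r n) : ℝ) := by
    have h2 : ((r n : ℝ) * (n : ℝ) ^ (ε / 2)) ^ r n ≤ (n : ℝ) ^ r n := by gcongr
    rw [mul_pow] at h2
    exact le_of_mul_le_mul_left (h2.trans hch) (by positivity)
  have := Real.logb_le_logb_of_le (b := 2) (by norm_num) (by positivity) hkey
  rw [Real.logb_pow, Real.logb_rpow_eq_mul_logb_of_pos hnpos] at this
  linarith

/-! ### Necessity: counting decodable vectors by the bits probed -/

namespace ProbeTree

/-- The set of positions read when the tree is run on `w`. -/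
def probes {m : ℕ} (w : Fin m → Bool) : ProbeTree m → Finset (Fin m)
  | .leaf _ => ∅
  | .probe i t₀ t₁ => insert i (if w i = true then t₁.probes w else t₀.probes w)

theorem card_probes_le {m : ℕ} (w : Fin m → Bool) (T : ProbeTree m) :
    (T.probes w).card ≤ T.depth := by
  induction T with
  | leaf b => simp [probes]
  | probe i t₀ t₁ h₀ h₁ =>
    refine (Finset.card_insert_le _ _).trans ?_
    simp only [depth]
    split <;> omega

theorem eval_congr {m : ℕ} {w w' : Fin m → Bool} (T : ProbeTree m)
    (h : ∀ i ∈ T.probes w, w i = w' i) : T.eval w = T.eval w' := by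
  induction T with
  | leaf b => rfl
  | probe i t₀ t₁ h₀ h₁ =>
    simp only [probes, Finset.mem_insert, forall_eq_or_imp] at h
    obtain ⟨hi, h⟩ := h
    simp only [eval, ← hi]
    split_ifs with hw
    · exact h₁ (by simpa [hw] using h)
    · exact h₀ (by simpa [hw] using h)

end ProbeTree

/-- The weight of a symbol in a partial assignment: each assigned position contributes `t`. -/
noncomputable def assignWeight (t : ℝ) (o : Option Bool) : ℝ := if o = none then 1 else t

theorem sum_prod_assignWeight (t : ℝ) (m : ℕ) :
    ∑ p : Fin m → Option Bool, ∏ i, assignWeight t (p i) = (1 + 2 * t) ^ m := by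
  rw [← Fintype.sum_pow]
  congr 1
  simp [assignWeight, Fintype.sum_option]

/-- The sparse vectors whose codewords have a given length are determined by the partial assignment
read while decoding their ones, hence there are few of them. -/
theorem IsLocallyDecodable.card_length_eq_mul_pow_le {r d n : ℕ} {c : SparseVec n r → List Bool}
    (h : IsLocallyDecodable r d n c) (m : ℕ) {t : ℝ} (ht : 0 < t) (ht1 : t ≤ 1) :
    ((Finset.univ.filter fun x => (c x).length = m).card : ℝ) * t ^ (r * d) ≤ (1 + 2 * t) ^ m := by
  classical
  obtain ⟨dec, hd, hdec⟩ := h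
  -- The default `false` only makes `w` total; it is never read when the codeword has length `m`.
  let w : SparseVec n r → Fin m → Bool := fun x i => (c x).getD i false
  have hw : ∀ x, (c x).length = m → ∀ j, (dec m j).eval (w x) = x.1 j := by
    rintro x rfl j
    rw [← hdec x j]
    congr 1
    ext i
    simp [w]
  let Q : SparseVec n r → Finset (Fin m) := fun x =>
    (Finset.univ.filter fun j => x.1 j = true).biUnion fun j => (dec m j).probes (w x)
  have hQ : ∀ x, (Q x).card ≤ r * d := by
    intro x
    refine Finset.card_biUnion_le.trans ?_
    refine (Finset.sum_le_card_nsmul _ _ d fun j _ =>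
      ((dec m j).card_probes_le _).trans (hd m j)).trans ?_
    rw [x.2, smul_eq_mul]
  let p : SparseVec n r → Fin m → Option Bool := fun x i => if i ∈ Q x then some (w x i) else none
  -- The codeword of `y` agrees with that of `x` wherever a one of `x` is decoded, so the decoder
  -- also finds a one in `y`. By symmetry `p` is injective.
  have hsub : ∀ x y, (c x).length = m → (c y).length = m → p x = p y →
      ∀ j, x.1 j = true → y.1 j = true := by
    intro x y hx hy hxy j hj
    rw [← hw x hx j] at hj
    rw [← hw y hy j, ← hj]
    refine ((dec m j).eval_congr fun i hi => ?_).symm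
    have hiQ : i ∈ Q x := Finset.mem_biUnion.2 ⟨j, by simpa [hw x hx j] using hj, hi⟩
    have := congrFun hxy i
    simp only [p, if_pos hiQ] at this
    split_ifs at this
    exact Option.some.inj this
  have hinj : Set.InjOn p (Finset.univ.filter fun x => (c x).length = m : Finset _) := by
    intro x hx y hy hxy
    have hx' : (c x).length = m := by simpa using hx
    have hy' : (c y).length = m := by simpa using hy
    ext j
    exact Bool.eq_iff_iff.2 ⟨hsub x y hx' hy' hxy j, hsub y x hy' hx' hxy.symm j⟩
  have hwt : ∀ x, t ^ (r * d) ≤ ∏ i, assignWeight t (p x i) := by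
    intro x
    have : ∏ i, assignWeight t (p x i) = t ^ (Q x).card := by
      rw [← Finset.prod_const, ← Finset.prod_filter_mul_prod_filter_not Finset.univ (· ∈ Q x)]
      rw [Finset.prod_congr rfl (g := fun _ => t),
        Finset.prod_congr (s₁ := Finset.univ.filter (· ∉ Q x)) rfl (g := fun _ => (1 : ℝ))]
      · simp
      · intro i hi
        simp only [Finset.mem_filter, Finset.mem_univ, true_and] at hi
        simp [p, hi, assignWeight]
      · intro i hi
        simp only [Finset.mem_filter, Finset.mem_univ, true_and] at hi
        simp [p, hi, assignWeight]
    rw [this]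
    exact pow_le_pow_of_le_one ht.le ht1 (hQ x)
  rw [← sum_prod_assignWeight, ← nsmul_eq_mul]
  refine (Finset.card_nsmul_le_sum _ (fun x => ∏ i, assignWeight t (p x i)) _
    fun x _ => hwt x).trans ?_
  rw [← Finset.sum_image (f := fun q => ∏ i, assignWeight t (q i)) hinj]
  refine Finset.sum_le_sum_of_subset_of_nonneg (Finset.subset_univ _) fun q _ _ =>
    Finset.prod_nonneg fun i _ => ?_
  unfold assignWeight
  split_ifs <;> linarith

/-- A geometric sum over lengths, multiplied by `2 * t` (the ratio minus one) to avoid dividing. The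
factor 2 later pays for Markov's inequality. -/
theorem IsLocallyDecodable.card_length_le_mul_pow_le {r d n : ℕ} {c : SparseVec n r → List Bool}
    (h : IsLocallyDecodable r d n c) (M : ℕ) {t : ℝ} (ht : 0 < t) (ht1 : t ≤ 1) :
    2 * ((Finset.univ.filter fun x => (c x).length ≤ M).card : ℝ) * t ^ (r * d + 1) ≤
      (1 + 2 * t) ^ (M + 1) := by
  have h1 : ((Finset.univ.filter fun x => (c x).length ≤ M).card : ℝ) * t ^ (r * d) ≤
      ∑ m ∈ Finset.range (M + 1), (1 + 2 * t) ^ m := by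
    have : (Finset.univ.filter fun x => (c x).length ≤ M).card =
        ∑ m ∈ Finset.range (M + 1), (Finset.univ.filter fun x => (c x).length = m).card := by
      rw [Finset.card_eq_sum_card_fiberwise (f := fun x => (c x).length)
        (t := Finset.range (M + 1))]
      · refine Finset.sum_congr rfl fun m hm => ?_
        rw [Finset.filter_filter]
        congr 1
        ext x
        simp only [Finset.mem_filter, Finset.mem_univ, true_and, Finset.mem_range] at hm ⊢
        omega
      · intro x hx
        simp only [Finset.coe_filter, Finset.mem_univ, true_and, Set.mem_ofPred_eq] at hx
        simpa [Nat.lt_succ_iff] using hx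
    rw [this]
    push_cast
    rw [Finset.sum_mul]
    exact Finset.sum_le_sum fun m _ => h.card_length_eq_mul_pow_le m ht ht1
  have h2 := geom_sum_mul (1 + 2 * t) (M + 1)
  have h3 := mul_le_mul_of_nonneg_right h1 (show (0 : ℝ) ≤ 2 * t by positivity)
  rw [show (1 + 2 * t - 1) = 2 * t by ring] at h2
  rw [h2] at h3
  calc _ = ((Finset.univ.filter fun x => (c x).length ≤ M).card : ℝ) * t ^ (r * d) * (2 * t) := by
        ring
    _ ≤ _ := h3.trans (by linarith)

/-- Markov's inequality for the codeword length. -/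
theorem card_le_two_mul_card_length_le {r n : ℕ} (c : SparseVec n r → List Bool) {M : ℕ}
    (hM : 2 * expectedLength c < M + 1) :
    Fintype.card (SparseVec n r) ≤
      2 * (Finset.univ.filter fun x => (c x).length ≤ M).card := by
  rcases Nat.eq_zero_or_pos (Fintype.card (SparseVec n r)) with h0 | h0
  · omega
  have h0' : (0 : ℝ) < Fintype.card (SparseVec n r) := by exact_mod_cast h0
  have hsum : 2 * ∑ x : SparseVec n r, ((c x).length : ℝ) <
      (M + 1) * Fintype.card (SparseVec n r) := by
    rwa [expectedLength, ← mul_div_assoc, div_lt_iff₀ h0'] at hM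
  have hsum' : 2 * ∑ x : SparseVec n r, (c x).length < (M + 1) * Fintype.card (SparseVec n r) := by
    exact_mod_cast hsum
  have hbig : (Finset.univ.filter fun x => ¬ (c x).length ≤ M).card * (M + 1) ≤
      ∑ x : SparseVec n r, (c x).length := by
    refine le_trans ?_ (Finset.sum_le_sum_of_subset (Finset.subset_univ
      (Finset.univ.filter fun x => ¬ (c x).length ≤ M)))
    rw [← smul_eq_mul]
    refine Finset.card_nsmul_le_sum _ _ _ fun x hx => ?_
    simp only [Finset.mem_filter, Finset.mem_univ, true_and] at hx
    omega
  have hadd := Finset.card_filter_add_card_filter_not (s := (Finset.univ : Finset (SparseVec n r)))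
    (fun x => (c x).length ≤ M)
  rw [Finset.card_univ] at hadd
  nlinarith

/-- The trade-off between the probe complexity and the expected length of a locally decodable
code. -/
theorem IsLocallyDecodable.logb_choose_le {r d n : ℕ} {c : SparseVec n r → List Bool}
    (h : IsLocallyDecodable r d n c) (hrn : r ≤ n) (a : ℕ) :
    Real.logb 2 (n.choose r : ℝ) ≤
      (r * d + 1) * a + (2 * expectedLength c + 1) * (4 * (1 / 2) ^ a) := by
  set t : ℝ := (1 / 2) ^ a with ht_def
  have ht : 0 < t := by positivity
  have ht1 : t ≤ 1 := pow_le_one₀ (by norm_num) (by norm_num)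
  have hE : 0 ≤ expectedLength c := by unfold expectedLength; positivity
  set M := ⌊2 * expectedLength c⌋₊ with hM
  have hMle : (M : ℝ) ≤ 2 * expectedLength c := Nat.floor_le (by positivity)
  have h1 := card_le_two_mul_card_length_le c (M := M) (Nat.lt_floor_add_one _)
  have h1' : (n.choose r : ℝ) ≤ 2 * (Finset.univ.filter fun x => (c x).length ≤ M).card := by
    rw [← card_sparseVec]; exact_mod_cast h1
  have h2 := h.card_length_le_mul_pow_le M ht ht1
  have hpos : (0 : ℝ) < n.choose r := by exact_mod_cast Nat.choose_pos hrn
  have h3 : (n.choose r : ℝ) * t ^ (r * d + 1) ≤ (1 + 2 * t) ^ (M + 1) :=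
    le_trans (by gcongr) h2
  have h4 := Real.logb_le_logb_of_le (b := 2) (by norm_num) (by positivity) h3
  rw [Real.logb_mul hpos.ne' (by positivity), Real.logb_pow, Real.logb_pow, ht_def, Real.logb_pow,
    ← ht_def, one_div, Real.logb_inv, Real.logb_self_eq_one (by norm_num)] at h4
  -- Uses `log (1 + 2 * t) ≤ 2 * t` and `log 2 ≥ 1 / 2`.
  have h5 : Real.logb 2 (1 + 2 * t) ≤ 4 * t := by
    rw [Real.logb, div_le_iff₀ (Real.log_pos (by norm_num))]
    have := Real.log_le_sub_one_of_pos (show 0 < 1 + 2 * t by positivity)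
    have := Real.log_two_gt_d9
    nlinarith
  have h6 : ((M + 1 : ℕ) : ℝ) * Real.logb 2 (1 + 2 * t) ≤
      (2 * expectedLength c + 1) * (4 * t) := by
    push_cast
    gcongr
    exact Real.logb_nonneg (by norm_num) (by linarith)
  push_cast at h4 h6
  linarith

theorem logb_isBigO_of_isCompetitivelyOptimal {r d : ℕ → ℕ} (hr_pos : ∀ n : ℕ, 1 ≤ n → 1 ≤ r n)
    (hr : ∃ ε : ℝ, 0 < ε ∧
      (fun n : ℕ => (r n : ℝ)) =O[atTop] (fun n : ℕ => (n : ℝ) ^ (1 - ε)))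
    {c : (n : ℕ) → SparseVec n (r n) → List Bool}
    (hc : ∀ n : ℕ, 1 ≤ n → IsLocallyDecodable (r n) (d n) n (c n))
    (hopt : IsCompetitivelyOptimal r c) :
    (fun n : ℕ => Real.logb 2 (n : ℝ)) =O[atTop] (fun n : ℕ => (d n : ℝ)) := by
  obtain ⟨κ, hκ, hent⟩ := exists_mul_logb_le_logb_choose hr_pos hr
  obtain ⟨K, hK, -⟩ := EReal.lt_iff_exists_real_btwn.1 hopt
  have hK := eventually_lt_of_limsup_lt hK
  -- With `t` this small, the length term is at most half the entropy plus one and can be absorbed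
  -- on the left.
  obtain ⟨a, ha⟩ := exists_pow_lt_of_lt_one (show (0 : ℝ) < 1 / (16 * (max K 1)) by positivity)
    (show (1 / 2 : ℝ) < 1 by norm_num)
  set t : ℝ := (1 / 2) ^ a with ht_def
  have hK1 : 1 ≤ max K 1 := le_max_right _ _
  rw [lt_div_iff₀ (by positivity)] at ha
  have ht : 0 < t := by positivity
  have hlog : Tendsto (fun n : ℕ => Real.logb 2 (n : ℝ)) atTop atTop :=
    (Real.tendsto_logb_atTop (by norm_num)).comp tendsto_natCast_atTop_atTop
  refine IsBigO.of_bound (4 * a / κ) ?_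
  filter_upwards [hent, hK, hlog.eventually_ge_atTop 1,
    hlog.eventually_ge_atTop (4 * (a + 1) / κ), eventually_ge_atTop 1] with n hn hKn hl1 hl hn1
  have hr1 : (1 : ℝ) ≤ r n := by exact_mod_cast hr_pos n hn1
  set ℓ := Real.logb 2 (n : ℝ)
  set H := Real.logb 2 (n.choose (r n) : ℝ) with hH
  have hHpos : 0 < H := lt_of_lt_of_le (by positivity) hn
  -- Otherwise the binomial is 0 and `Real.logb 2 0 = 0` contradicts `H > 0`.
  have hrn : r n ≤ n := by
    by_contra hlt
    rw [hH, Nat.choose_eq_zero_of_lt (by omega)] at hHpos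
    simp at hHpos
  have hKn : expectedLength (c n) / H < K := by exact_mod_cast hKn
  have hE : expectedLength (c n) ≤ max K 1 * H := by
    rw [div_lt_iff₀ hHpos] at hKn
    exact hKn.le.trans (by gcongr; exact le_max_left _ _)
  have hmain := (hc n hn1).logb_choose_le hrn a
  rw [← hH, ← ht_def] at hmain
  have h1 : (2 * expectedLength (c n) + 1) * (4 * t) ≤ H / 2 + 1 := by
    have : expectedLength (c n) * t ≤ max K 1 * H * t := by gcongr
    have : (t * (16 * max K 1)) * H ≤ 1 * H := by gcongr
    nlinarith
  have h2 : κ * (r n * ℓ) ≤ r n * (2 * (d n * a + (a + 1))) := by nlinarith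
  have h3 : κ * ℓ ≤ 2 * (d n * a + (a + 1)) :=
    le_of_mul_le_mul_left (by linarith) (show (0 : ℝ) < r n by linarith)
  rw [div_le_iff₀ hκ] at hl
  rw [Real.norm_of_nonneg (by linarith), Real.norm_of_nonneg (by positivity), div_mul_eq_mul_div,
    le_div_iff₀ hκ]
  linarith

/-! ### Sufficiency: Bloom filters with a verbatim fallback -/

/-- Without any probe, a sparse vector can be conveyed by the length of its codeword alone. -/
theorem exists_isLocallyDecodable (r d n : ℕ) :
    ∃ c : SparseVec n r → List Bool, IsLocallyDecodable r d n c := by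
  classical
  let e := Fintype.equivFin (SparseVec n r)
  refine ⟨fun x => List.replicate (e x) false, fun m j =>
    .leaf (if h : m < Fintype.card (SparseVec n r) then (e.symm ⟨m, h⟩).1 j else false),
    fun m j => by simp [ProbeTree.depth], fun x j => ?_⟩
  simp [ProbeTree.eval]

namespace ProbeTree

/-- The tree checking that all listed positions exist and carry a one. -/
def allOnes (m : ℕ) : List ℕ → ProbeTree m
  | [] => .leaf true
  | p :: ps => if h : p < m then .probe ⟨p, h⟩ (.leaf false) (allOnes m ps) else .leaf false

theorem depth_allOnes_le (m : ℕ) (ps : List ℕ) : (allOnes m ps).depth ≤ ps.length := by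
  induction ps with
  | nil => simp [allOnes, depth]
  | cons p ps ih =>
    unfold allOnes
    split_ifs <;> simp [depth, ih]

theorem eval_allOnes (l : List Bool) (ps : List ℕ) :
    (allOnes l.length ps).eval l.get = true ↔ ∀ p ∈ ps, l[p]? = some true := by
  induction ps with
  | nil => simp [allOnes, eval]
  | cons p ps ih =>
    unfold allOnes
    split_ifs with h
    · by_cases hp : l[p] = true <;> simp [eval, h, hp, ih]
    · simp [eval, h]

end ProbeTree

section Bloom

variable {n r d m : ℕ}

/-- The positions hit by the ones of `x` under the hash functions `h`. -/
def bloomSupport (h : Fin n → Fin d → Fin m) (x : SparseVec n r) : Finset (Fin m) :=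
  (Finset.univ.filter fun j => x.1 j = true).biUnion fun j => Finset.univ.image (h j)

/-- The Bloom filter of `x` has a false positive. -/
def BloomCollision (h : Fin n → Fin d → Fin m) (x : SparseVec n r) : Prop :=
  ∃ j, x.1 j = false ∧ ∀ k, h j k ∈ bloomSupport h x

theorem card_bloomSupport_le (h : Fin n → Fin d → Fin m) (x : SparseVec n r) :
    (bloomSupport h x).card ≤ r * d := by
  refine Finset.card_biUnion_le.trans ?_
  refine (Finset.sum_le_card_nsmul _ _ d fun j _ =>
    Finset.card_image_le.trans (by simp)).trans ?_
  rw [x.2, smul_eq_mul]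

theorem bloomSupport_update (h : Fin n → Fin d → Fin m) (x : SparseVec n r) {j : Fin n}
    (hj : x.1 j = false) (v : Fin d → Fin m) :
    bloomSupport (Function.update h j v) x = bloomSupport h x := by
  refine Finset.biUnion_congr rfl fun i hi => ?_
  have : i ≠ j := by
    rintro rfl
    simp [hj] at hi
  rw [Function.update_of_ne this]

/-- A false positive at `j` has probability at most `(r * d / m) ^ d`: as `x j = 0`, the hashes of
`j` are independent of the support. -/
theorem card_falsePositive_mul_le (x : SparseVec n r) {j : Fin n} (hj : x.1 j = false) :
    (Finset.univ.filter fun h : Fin n → Fin d → Fin m => ∀ k, h j k ∈ bloomSupport h x).card *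
      m ^ d ≤ Fintype.card (Fin n → Fin d → Fin m) * (r * d) ^ d := by
  classical
  -- Swapping the hashes of `j` with a free `v` turns independence into an injection.
  have hinj := Finset.card_le_card_of_injOn
    (s := (Finset.univ.filter fun h : Fin n → Fin d → Fin m => ∀ k, h j k ∈ bloomSupport h x) ×ˢ
      (Finset.univ : Finset (Fin d → Fin m)))
    (t := Finset.univ.sigma fun h : Fin n → Fin d → Fin m =>
      Fintype.piFinset fun _ : Fin d => bloomSupport h x)
    (fun q => ⟨Function.update q.1 j q.2, q.1 j⟩) ?_ ?_
  · rw [Finset.card_product, Finset.card_univ, Fintype.card_fun, Fintype.card_fin, Fintype.card_fin,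
      Finset.card_sigma] at hinj
    refine hinj.trans ?_
    rw [← Finset.card_univ, ← smul_eq_mul]
    refine Finset.sum_le_card_nsmul _ _ _ fun h _ => ?_
    rw [Fintype.card_piFinset_const]
    exact Nat.pow_le_pow_left (card_bloomSupport_le h x) d
  · rintro ⟨h, v⟩ hq
    simpa [bloomSupport_update _ x hj] using hq
  · rintro ⟨h, v⟩ - ⟨h', v'⟩ - heq
    simp only [Sigma.mk.injEq, heq_eq_eq] at heq
    obtain ⟨h1, h2⟩ := heq
    have hv : v = v' := by simpa using congrFun h1 j
    have hh : h = h' := by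
      funext i
      by_cases hi : i = j
      · rw [hi, h2]
      · simpa [Function.update_of_ne hi] using congrFun h1 i
    rw [hv, hh]

open Classical in
/-- Some choice of hash functions has collisions for at most a fraction `1 / n` of the vectors. -/
theorem exists_card_bloomCollision_mul_le {s : ℕ} (hr : 0 < r) (hd : 0 < d)
    (hs : n ^ 2 ≤ 2 ^ (s * d)) :
    ∃ h : Fin n → Fin d → Fin (r * d * 2 ^ s),
      (Finset.univ.filter fun x : SparseVec n r => BloomCollision h x).card * n ≤
        Fintype.card (SparseVec n r) := by
  set m := r * d * 2 ^ s with hm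
  have hm0 : 0 < m := by positivity
  rcases Nat.eq_zero_or_pos n with rfl | hn
  · exact ⟨fun j => j.elim0, by simp⟩
  set N := Fintype.card (Fin n → Fin d → Fin m) with hN
  -- At most a fraction `2 ^ (-s)` of the filter is ones, so each index fails with probability at
  -- most `2 ^ (-s * d) ≤ n ^ (-2)`; a union bound over `j` and averaging over `h` follow.
  have hfix : ∀ (x : SparseVec n r) (j : Fin n), x.1 j = false →
      (Finset.univ.filter fun h : Fin n → Fin d → Fin m => ∀ k, h j k ∈ bloomSupport h x).card *
        n ^ 2 ≤ N := by
    intro x j hj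
    have h1 := card_falsePositive_mul_le (d := d) (m := m) x hj
    rw [hm, mul_pow _ (2 ^ s), ← hm, ← pow_mul] at h1
    refine (Nat.mul_le_mul_left _ hs).trans ?_
    refine Nat.le_of_mul_le_mul_left (c := (r * d) ^ d) ?_ (by positivity)
    calc _ = _ := by ring
      _ ≤ _ := h1
      _ = _ := by ring
  have hvec : ∀ x : SparseVec n r,
      (Finset.univ.filter fun h : Fin n → Fin d → Fin m => BloomCollision h x).card * n ≤ N := by
    intro x
    have hsub : (Finset.univ.filter fun h : Fin n → Fin d → Fin m => BloomCollision h x) ⊆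
        (Finset.univ.filter fun j => x.1 j = false).biUnion fun j =>
          Finset.univ.filter fun h : Fin n → Fin d → Fin m => ∀ k, h j k ∈ bloomSupport h x := by
      intro h hh
      obtain ⟨j, hj, hk⟩ := (Finset.mem_filter.1 hh).2
      exact Finset.mem_biUnion.2 ⟨j, by simpa using hj, by simpa using hk⟩
    have hle := (Finset.card_le_card hsub).trans Finset.card_biUnion_le
    refine Nat.le_of_mul_le_mul_right (c := n) ?_ hn
    calc _ = (Finset.univ.filter fun h : Fin n → Fin d → Fin m => BloomCollision h x).card *
          n ^ 2 := by ring
      _ ≤ _ := Nat.mul_le_mul_right _ hle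
      _ ≤ (Finset.univ.filter fun j => x.1 j = false).card • N := by
        rw [Finset.sum_mul]
        exact Finset.sum_le_card_nsmul _ _ _ fun j hj => hfix x j (by simpa using hj)
      _ ≤ n * N := by
        rw [smul_eq_mul]
        gcongr
        exact (Finset.card_le_univ _).trans (by simp)
      _ = N * n := mul_comm _ _
  have hswap : ∑ h : Fin n → Fin d → Fin m,
      (Finset.univ.filter fun x : SparseVec n r => BloomCollision h x).card * n ≤
      ∑ _h : Fin n → Fin d → Fin m, Fintype.card (SparseVec n r) := by
    rw [← Finset.sum_mul]
    have := Finset.sum_card_bipartiteAbove_eq_sum_card_bipartiteBelow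
      (s := (Finset.univ : Finset (Fin n → Fin d → Fin m)))
      (t := (Finset.univ : Finset (SparseVec n r))) (fun h x => BloomCollision h x)
    simp only [Finset.bipartiteAbove, Finset.bipartiteBelow] at this
    rw [this, Finset.sum_mul]
    refine (Finset.sum_le_card_nsmul _ _ N fun x _ => hvec x).trans ?_
    simp [hN, mul_comm]
  have : Nonempty (Fin n → Fin d → Fin m) := ⟨fun _ _ => ⟨0, hm0⟩⟩
  obtain ⟨h, -, hh⟩ := Finset.exists_le_of_sum_le Finset.univ_nonempty hswap
  exact ⟨h, hh⟩

open Classical in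
/-- The Bloom filter of `x`, replaced by a padded copy of `x` in case of a collision. -/
noncomputable def bloomCode (h : Fin n → Fin d → Fin m) (x : SparseVec n r) : List Bool :=
  if BloomCollision h x then List.ofFn x.1 ++ List.replicate (m + 1) false
  else List.ofFn fun i => decide (i ∈ bloomSupport h x)

/-- Fallback words are longer than `m`, so the length selects the format: test all hashes of `j`, or
read bit `j` alone. -/
theorem isLocallyDecodable_bloomCode {d' : ℕ} (h : Fin n → Fin d → Fin m) (hd : 0 < d)
    (hdd' : d ≤ d') : IsLocallyDecodable r d' n (bloomCode (r := r) h) := by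
  classical
  refine ⟨fun l j => .allOnes l (if l = m then List.ofFn fun k => (h j k : ℕ) else [(j : ℕ)]),
    fun l j => (ProbeTree.depth_allOnes_le _ _).trans ?_, fun x j => ?_⟩
  · split_ifs <;> simp <;> omega
  · rw [Bool.eq_iff_iff, ProbeTree.eval_allOnes]
    by_cases hx : BloomCollision h x
    · have hlen : (bloomCode h x).length ≠ m := by
        simp [bloomCode, hx]
        omega
      rw [if_neg hlen]
      simp [bloomCode, hx, List.getElem?_append]
    · have hlen : (bloomCode h x).length = m := by simp [bloomCode, hx]
      rw [if_pos hlen]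
      simp only [bloomCode, hx, if_false, List.forall_mem_ofFn_iff, List.getElem?_ofFn, Fin.is_lt,
        dite_true, Option.some.injEq, decide_eq_true_eq, Fin.eta]
      constructor
      · intro hk
        by_contra hj
        exact hx ⟨j, by simpa using hj, hk⟩
      · intro hj k
        exact Finset.mem_biUnion.2 ⟨j, by simpa using hj, by simp⟩

open Classical in
theorem expectedLength_bloomCode_le (h : Fin n → Fin d → Fin m) (hn : 1 ≤ n)
    (hh : (Finset.univ.filter fun x : SparseVec n r => BloomCollision h x).card * n ≤
      Fintype.card (SparseVec n r)) :
    expectedLength (bloomCode (r := r) h) ≤ m + 2 := by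
  have hlen : ∀ x : SparseVec n r,
      (bloomCode h x).length = m + if BloomCollision h x then n + 1 else 0 := by
    intro x
    unfold bloomCode
    split_ifs <;> simp
    omega
  have hsum : ∑ x : SparseVec n r, (bloomCode h x).length ≤
      (m + 2) * Fintype.card (SparseVec n r) := by
    simp only [hlen, Finset.sum_add_distrib, Finset.sum_ite, Finset.sum_const, Finset.card_univ,
      smul_eq_mul]
    nlinarith
  rw [expectedLength]
  refine div_le_of_le_mul₀ (by positivity) (by positivity) ?_
  exact_mod_cast hsum

end Bloom

/-- Optimal codes exist as soon as the number of probes is at least of order `log₂ n`. -/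
theorem exists_isCompetitivelyOptimal {r d : ℕ → ℕ} (hr_pos : ∀ n : ℕ, 1 ≤ n → 1 ≤ r n)
    (hr : ∃ ε : ℝ, 0 < ε ∧
      (fun n : ℕ => (r n : ℝ)) =O[atTop] (fun n : ℕ => (n : ℝ) ^ (1 - ε)))
    (hd : (fun n : ℕ => Real.logb 2 (n : ℝ)) =O[atTop] (fun n : ℕ => (d n : ℝ))) :
    ∃ c : (n : ℕ) → SparseVec n (r n) → List Bool,
      (∀ n : ℕ, 1 ≤ n → IsLocallyDecodable (r n) (d n) n (c n)) ∧ IsCompetitivelyOptimal r c := by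
  obtain ⟨κ, hκ, hent⟩ := exists_mul_logb_le_logb_choose hr_pos hr
  obtain ⟨C, hC, hdC⟩ := hd.exists_pos
  -- With `D ≥ ℓ / C` hashes, `s * D ≥ 2 * ℓ`, hence `2 ^ (s * D) ≥ n ^ 2`.
  set s := ⌈2 * C⌉₊ with hs
  set K : ℝ := (1 / C + 1) * 2 ^ s + 2 with hK
  have hlog : Tendsto (fun n : ℕ => Real.logb 2 (n : ℝ)) atTop atTop :=
    (Real.tendsto_logb_atTop (by norm_num)).comp tendsto_natCast_atTop_atTop
  have hex : ∀ᶠ n : ℕ in atTop, ∃ c : SparseVec n (r n) → List Bool,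
      IsLocallyDecodable (r n) (d n) n c ∧
        expectedLength c / Real.logb 2 (n.choose (r n) : ℝ) ≤ K / κ := by
    filter_upwards [hent, hdC.bound, hlog.eventually_ge_atTop 1, eventually_ge_atTop 1]
      with n hn hdn hl1 hn1
    set ℓ := Real.logb 2 (n : ℝ) with hℓ
    have hn0 : (0 : ℝ) < n := by exact_mod_cast hn1
    have hr1 : (1 : ℝ) ≤ r n := by exact_mod_cast hr_pos n hn1
    rw [Real.norm_of_nonneg (by linarith), Real.norm_of_nonneg (by positivity)] at hdn
    -- Not `d n` itself, which may far exceed `log n` and make the filter too long.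
    set D := ⌈ℓ / C⌉₊ with hD
    have hD0 : 0 < D := Nat.ceil_pos.2 (by positivity)
    have hDd : D ≤ d n := Nat.ceil_le.2 (by rwa [div_le_iff₀ hC, mul_comm])
    have hD1 : ℓ / C ≤ D := Nat.le_ceil _
    have hD2 : (D : ℝ) ≤ ℓ / C + 1 := (Nat.ceil_lt_add_one (by positivity)).le
    have hpow : n ^ 2 ≤ 2 ^ (s * D) := by
      have h1 : 2 * ℓ ≤ ((s * D : ℕ) : ℝ) := by
        push_cast
        calc 2 * ℓ = (2 * C) * (ℓ / C) := by field_simp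
          _ ≤ s * D := by
            gcongr
            exact Nat.le_ceil _
      have h2 : ((n : ℝ)) ^ 2 ≤ 2 ^ (s * D) := by
        calc (n : ℝ) ^ 2 = (2 : ℝ) ^ (ℓ * 2) := by
              rw [Real.rpow_mul (by norm_num), hℓ,
                Real.rpow_logb (by norm_num) (by norm_num) hn0]
              norm_cast
          _ ≤ (2 : ℝ) ^ ((s * D : ℕ) : ℝ) := by
            apply Real.rpow_le_rpow_of_exponent_le (by norm_num)
            linarith
          _ = 2 ^ (s * D) := Real.rpow_natCast _ _
      exact_mod_cast h2
    obtain ⟨h, hh⟩ := exists_card_bloomCollision_mul_le (hr_pos n hn1) hD0 hpow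
    refine ⟨bloomCode h, isLocallyDecodable_bloomCode h hD0 hDd, ?_⟩
    have hE := expectedLength_bloomCode_le h hn1 (by convert hh)
    have hH : 0 < Real.logb 2 (n.choose (r n) : ℝ) := lt_of_lt_of_le (by positivity) hn
    rw [div_le_div_iff₀ hH hκ]
    have hrl : 1 ≤ r n * ℓ := by nlinarith
    have hEK : expectedLength (bloomCode (r := r n) h) ≤ K * (r n * ℓ) := by
      refine hE.trans ?_
      push_cast
      calc (r n * D * 2 ^ s + 2 : ℝ) ≤ r n * (ℓ / C + ℓ) * 2 ^ s + 2 * (r n * ℓ) := by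
            gcongr
            · linarith
            · linarith
        _ = K * (r n * ℓ) := by rw [hK]; ring
    calc _ ≤ K * (r n * ℓ) * κ := by gcongr
      _ = K * (κ * (r n * ℓ)) := by ring
      _ ≤ _ := by gcongr
  -- Decodability is needed at every `n`, even where too few probes are allowed for the filter.
  -- There the code carried by its length alone serves, and the limsup ignores it.
  have hall : ∀ n : ℕ, ∃ c : SparseVec n (r n) → List Bool,
      IsLocallyDecodable (r n) (d n) n c ∧
        ((∃ c : SparseVec n (r n) → List Bool, IsLocallyDecodable (r n) (d n) n c ∧
          expectedLength c / Real.logb 2 (n.choose (r n) : ℝ) ≤ K / κ) →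
        expectedLength c / Real.logb 2 (n.choose (r n) : ℝ) ≤ K / κ) := by
    intro n
    by_cases h : ∃ c : SparseVec n (r n) → List Bool, IsLocallyDecodable (r n) (d n) n c ∧
        expectedLength c / Real.logb 2 (n.choose (r n) : ℝ) ≤ K / κ
    · obtain ⟨c, hc, hcE⟩ := h
      exact ⟨c, hc, fun _ => hcE⟩
    · obtain ⟨c, hc⟩ := exists_isLocallyDecodable (r n) (d n) n
      exact ⟨c, hc, fun h' => absurd h' h⟩
  choose c hc hcE using hall
  refine ⟨c, fun n _ => hc n, ?_⟩
  have hle : limsup (fun n : ℕ =>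
      ((expectedLength (c n) / Real.logb 2 (n.choose (r n) : ℝ) : ℝ) : EReal)) atTop ≤
      ((K / κ : ℝ) : EReal) := by
    refine limsup_le_of_le (by isBoundedDefault) ?_
    filter_upwards [hex] with n hn
    exact_mod_cast hcE n hn
  exact hle.trans_lt (EReal.coe_lt_top _)

theorem corollary2 (r d : ℕ → ℕ) (hr_pos : ∀ n : ℕ, 1 ≤ n → 1 ≤ r n)
    (hr : ∃ ε : ℝ, 0 < ε ∧
      (fun n : ℕ => (r n : ℝ)) =O[atTop] (fun n : ℕ => (n : ℝ) ^ (1 - ε))) :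
    (∃ c : (n : ℕ) → SparseVec n (r n) → List Bool,
        (∀ n : ℕ, 1 ≤ n → IsLocallyDecodable (r n) (d n) n (c n)) ∧
          IsCompetitivelyOptimal r c) ↔
      (fun n : ℕ => Real.logb 2 (n : ℝ)) =O[atTop] (fun n : ℕ => (d n : ℝ)) :=
  ⟨fun ⟨_, hc, hopt⟩ => logb_isBigO_of_isCompetitivelyOptimal hr_pos hr hc hopt,
    fun hd => exists_isCompetitivelyOptimal hr_pos hr hd⟩
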